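/- Let $\theta,s>0$. For $h>0$ let $\mathcal S_{\theta,h}^s(\mathbf R)$ be the set of all $f\in C^\infty(\mathbf R)$ (complex valued) such that $$\sup_{\alpha,\beta\in\mathbf N,\ x\in\mathbf R}\frac{|x^\alpha D^\beta f(x)|}{h^{\alpha+\beta}\,\alpha!^\theta\,\beta!^s}<\infty ,\qquad D=-i\,\frac{d}{dx},$$ and let $\mathcal S_\theta^s(\mathbf R)=\bigcup_{h>0}\mathcal S_{\theta,h}^s(\mathbf R)$ be the Roumieu type Gelfand--Shilov space. Let $q$ be a polynomial on $\mathbf R$ with real coefficients and degree $m\geqslant 2$, and define $(Tf)(x)=e^{iq(x)}f(x)$ for $x\in\mathbf R$. **Theorem.** If $$1\leqslant s<\theta m-\max(\theta,1),$$ and $\theta\geqslant 1$ if $m=3$, then $T\mathcal S_\theta^s(\mathbf R)\nsubseteq\mathcal S_\theta^s(\mathbf R)$. More precisely, the function $f(x)=e^{-\langle x\rangle^{1/\theta}}$, with $\langle x\rangle=(1+x^2)^{1/2}$, satisfies $f\in\mathcal S_\theta^1(\mathbf R)$, $f\in\mathcal S_\theta^s(\mathbf R)$ and $Tf\notin\mathcal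 S_\theta^s(\mathbf R)$. -/

import Mathlib

noncomputable section

namespace GelfandShilov

/-- The space `S_{θ,h}^s(ℝ)`: all smooth `f : ℝ → ℂ` for which
`|x^α D^β f(x)| / (h^(α+β) α!^θ β!^s)` is bounded uniformly in `α, β ∈ ℕ` and `x ∈ ℝ`.
(The factor `i^{-β}` in `D^β = i^{-β} ∂^β` has modulus one, so it is left out.) -/
def step (θ s h : ℝ) : Set (ℝ → ℂ) :=
  {f | ContDiff ℝ ((⊤ : ℕ∞) : WithTop ℕ∞) f ∧
    ∃ C : ℝ, ∀ (α β : ℕ) (x : ℝ),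
      ‖(x : ℂ) ^ α * iteratedDeriv β f x‖ ≤
        C * (h ^ (α + β) * (α.factorial : ℝ) ^ θ * (β.factorial : ℝ) ^ s)}

/-- The Roumieu type Gelfand--Shilov space `S_θ^s(ℝ) = ⋃_{h > 0} S_{θ,h}^s(ℝ)`
(as a set of functions). -/
def space (θ s : ℝ) : Set (ℝ → ℂ) :=
  ⋃ h ∈ Set.Ioi (0 : ℝ), step θ s h

/-- The operator `T` of multiplication by `e^{i q(x)}`. -/
def expMultiplier (q : Polynomial ℝ) (f : ℝ → ℂ) : ℝ → ℂ :=
  fun x => Complex.exp (Complex.I * ((q.eval x : ℝ) : ℂ)) * f x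

/-- The function `x ↦ exp (-⟨x⟩^{1/θ})`, where `⟨x⟩ = (1 + x²)^{1/2}`. -/
def expBracket (θ : ℝ) : ℝ → ℂ :=
  fun x => ((Real.exp (-(Real.sqrt (1 + x ^ 2) ^ (1 / θ))) : ℝ) : ℂ)

end GelfandShilov

end

namespace GelfandShilov

open Complex Metric Filter Topology

/-! The bracket function extends holomorphically to a strip and decays there like `exp (-c
|x|^(1/θ))`, so Cauchy estimates put it in the space for every `s ≥ 1`. For the negative part, fix a
large `x`, set `t = π / q'(x)` and `N = ⌊x^σ⌋`, and take the `N`-th forward difference of `exp (i q)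
f` at `x`. The phases at the nodes `x + k t` are nearly `q(x) + k π`, which cancels the alternating
signs of the difference (`two_pow_mul_le_norm_iterate_fwdDiff`): its norm is at least about `2^N exp
(-c x^(1/θ))`, which is unbounded when `σ > 1/θ`. Membership in the space would bound it by `C (|t|
h)^N N!^s` (`norm_iterate_fwdDiff_le`), which stays at most `C` when `σ s < m - 1`. -/

lemma abs_arg_le_abs_im_div_re {w : ℂ} (hw : 0 < w.re) : |w.arg| ≤ |w.im| / w.re := by
  have h1 : |w.arg| < Real.pi / 2 := abs_arg_lt_pi_div_two_iff.2 (Or.inl hw)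
  have h2 : Real.tan |w.arg| = |w.im| / w.re ∨ Real.tan |w.arg| = -(|w.im| / w.re) := by
    rcases abs_choice w.arg with h | h <;> rcases abs_choice w.im with h' | h' <;>
      simp [h, h', Real.tan_neg, tan_arg, neg_div]
  have h3 := Real.le_tan (abs_nonneg w.arg) h1
  have h4 : 0 ≤ |w.im| / w.re := by positivity
  rcases h2 with h | h <;> linarith

/-! ### Holomorphic extension and Cauchy estimates -/

/-- The holomorphic extension of `expBracket θ`, with `a = 1 / (2 θ)`. -/
noncomputable def complexExpBracket (a : ℝ) (z : ℂ) : ℂ := exp (-((1 + z ^ 2) ^ (a : ℂ)))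

lemma one_add_sq_re_ge {z : ℂ} (hz : |z.im| ≤ 1 / 2) :
    (1 + z.re ^ 2) / 2 ≤ (1 + z ^ 2).re := by
  have : z.im ^ 2 ≤ (1 / 2) ^ 2 := sq_le_sq' (abs_le.1 hz).1 (abs_le.1 hz).2
  simp [pow_two] at *
  nlinarith [mul_self_nonneg z.re]

/-- In a thin strip `1 + z²` has argument at most `2ρ`, so its `a`-th power has argument at most 1,
where the cosine is at least 1/2. -/
lemma cpow_one_add_sq_re_ge {a ρ : ℝ} (ha : 0 < a) (hρ : ρ ≤ 1 / 2) (haρ : 2 * ρ * a ≤ 1)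
    {z : ℂ} (hz : |z.im| ≤ ρ) :
    ((1 + z.re ^ 2) / 2) ^ a / 2 ≤ ((1 + z ^ 2) ^ (a : ℂ)).re := by
  have hre := one_add_sq_re_ge (hz.trans hρ)
  have hpos : 0 < (1 + z.re ^ 2) / 2 := by positivity
  have harg : |(1 + z ^ 2).arg| ≤ 2 * ρ := by
    refine (abs_arg_le_abs_im_div_re (hpos.trans_le hre)).trans ?_
    rw [div_le_iff₀ (hpos.trans_le hre)]
    have him : |(1 + z ^ 2).im| = 2 * |z.re| * |z.im| := by
      rw [mul_assoc, ← abs_mul, ← abs_two, ← abs_mul]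
      congr 1
      simp [pow_two]; ring
    have h1 : 2 * |z.re| ≤ 1 + z.re ^ 2 := by
      nlinarith [sq_nonneg (|z.re| - 1), sq_abs z.re]
    have hρ0 : 0 ≤ ρ := (abs_nonneg _).trans hz
    calc |(1 + z ^ 2).im| = 2 * |z.re| * |z.im| := him
      _ ≤ (1 + z.re ^ 2) * ρ := by gcongr
      _ = 2 * ρ * ((1 + z.re ^ 2) / 2) := by ring
      _ ≤ 2 * ρ * (1 + z ^ 2).re := by gcongr
  rw [cpow_ofReal_re]
  have hang : |(1 + z ^ 2).arg * a| ≤ 1 := by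
    rw [abs_mul, abs_of_pos ha]
    exact (mul_le_mul_of_nonneg_right harg ha.le).trans haρ
  have hcos : 1 / 2 ≤ Real.cos ((1 + z ^ 2).arg * a) := by
    have := Real.one_sub_sq_div_two_le_cos (x := (1 + z ^ 2).arg * a)
    have := (sq_le_one_iff_abs_le_one _).2 hang
    linarith
  have hnorm : (1 + z.re ^ 2) / 2 ≤ ‖1 + z ^ 2‖ := hre.trans (re_le_norm _)
  calc ((1 + z.re ^ 2) / 2) ^ a / 2 = ((1 + z.re ^ 2) / 2) ^ a * (1 / 2) := by ring
    _ ≤ _ := by gcongr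

lemma differentiableAt_complexExpBracket (a : ℝ) {z : ℂ} (hz : |z.im| ≤ 1 / 2) :
    DifferentiableAt ℂ (complexExpBracket a) z := by
  have hre := one_add_sq_re_ge hz
  have hslit : 1 + z ^ 2 ∈ slitPlane := Or.inl (lt_of_lt_of_le (by positivity) hre)
  unfold complexExpBracket
  have hbase : DifferentiableAt ℂ (fun z : ℂ => 1 + z ^ 2) z := by fun_prop
  exact (hbase.cpow (differentiableAt_const _) hslit).neg.cexp

lemma analyticAt_complexExpBracket (a : ℝ) (x : ℝ) :
    AnalyticAt ℂ (complexExpBracket a) x := by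
  have hopen : IsOpen {z : ℂ | |z.im| < 1 / 2} :=
    isOpen_lt (by fun_prop) continuous_const
  refine DifferentiableOn.analyticAt (s := {z : ℂ | |z.im| < 1 / 2})
    (fun z hz => (differentiableAt_complexExpBracket a (le_of_lt hz)).differentiableWithinAt)
    (hopen.mem_nhds (by simp))

lemma contDiff_comp_ofReal {F : ℂ → ℂ} (hF : ∀ x : ℝ, AnalyticAt ℂ F x) :
    ContDiff ℝ ((⊤ : ℕ∞) : WithTop ℕ∞) (fun x : ℝ => F x) := by
  rw [contDiff_iff_contDiffAt]
  intro x
  have h := ((hF x).contDiffAt (n := ((⊤ : ℕ∞) : WithTop ℕ∞))).restrict_scalars ℝ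
  exact h.comp x ofRealCLM.contDiff.contDiffAt

lemma iteratedDeriv_comp_ofReal {F : ℂ → ℂ} (hF : ∀ x : ℝ, AnalyticAt ℂ F x) (n : ℕ) :
    iteratedDeriv n (fun x : ℝ => F x) = fun x : ℝ => iteratedDeriv n F x := by
  induction n with
  | zero => simp
  | succ n ih =>
    ext x
    rw [iteratedDeriv_succ, ih, iteratedDeriv_succ]
    have h : AnalyticAt ℂ (iteratedDeriv n F) x := by
      rw [iteratedDeriv_eq_iterate]
      exact (hF x).iterated_deriv n
    exact h.differentiableAt.hasDerivAt.comp_ofReal.deriv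

lemma expBracket_eq (θ : ℝ) :
    expBracket θ = fun x : ℝ => complexExpBracket (1 / (2 * θ)) x := by
  ext x
  have h0 : (0 : ℝ) ≤ 1 + x ^ 2 := by positivity
  have h : Real.sqrt (1 + x ^ 2) ^ (1 / θ) = (1 + x ^ 2) ^ (1 / (2 * θ)) := by
    rw [Real.sqrt_eq_rpow, ← Real.rpow_mul h0]
    congr 1
    field_simp
  rw [expBracket, complexExpBracket, h, ofReal_exp, ofReal_neg, ofReal_cpow h0]
  push_cast
  rfl

/-- Cauchy estimates for `expBracket θ`. -/
lemma exists_norm_iteratedDeriv_expBracket_le {θ : ℝ} (hθ : 0 < θ) :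
    ∃ ρ c : ℝ, 0 < ρ ∧ 0 < c ∧ ∀ (n : ℕ) (x : ℝ),
      ‖iteratedDeriv n (expBracket θ) x‖ ≤
        n.factorial * Real.exp (-(c * |x| ^ (1 / θ))) / ρ ^ n := by
  set a : ℝ := 1 / (2 * θ) with ha_def
  have ha : 0 < a := by positivity
  -- The bound 1/2 keeps `1 + z²` in the right half-plane; `1 / (2a)` keeps the argument of its
  -- `a`-th power at most 1.
  set ρ : ℝ := min (1 / 2) (1 / (2 * a)) with hρ_def
  have hρ : 0 < ρ := by positivity
  have hρ1 : ρ ≤ 1 / 2 := min_le_left _ _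
  have hρ2 : 2 * ρ * a ≤ 1 := by
    have : ρ ≤ 1 / (2 * a) := min_le_right _ _
    rw [le_div_iff₀ (by positivity)] at this
    linarith
  refine ⟨ρ, (1 / 4) ^ a / 2, hρ, by positivity, fun n x => ?_⟩
  have him : ∀ z : ℂ, ‖z - x‖ ≤ ρ → |z.im| ≤ ρ := fun z hz => by
    simpa using (abs_im_le_norm (z - x)).trans hz
  rw [expBracket_eq, iteratedDeriv_comp_ofReal (analyticAt_complexExpBracket _)]
  refine norm_iteratedDeriv_le_of_forall_mem_sphere_norm_le n hρ ?_ ?_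
  · refine DifferentiableOn.diffContOnCl fun z hz => ?_
    have hz' : ‖z - x‖ ≤ ρ := by
      simpa [dist_eq_norm] using closure_ball_subset_closedBall hz
    exact (differentiableAt_complexExpBracket _
      ((him z hz').trans hρ1)).differentiableWithinAt
  · intro z hz
    have hz' : ‖z - x‖ ≤ ρ := by
      simpa [dist_eq_norm] using (mem_sphere.1 hz).le
    have hre : |z.re - x| ≤ 1 / 2 := by
      simpa using ((abs_re_le_norm (z - x)).trans hz').trans hρ1
    rw [complexExpBracket, norm_exp, Real.exp_le_exp, neg_re, neg_le_neg_iff]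
    refine le_trans ?_ (cpow_one_add_sq_re_ge ha hρ1 hρ2 (him z hz'))
    have hx : |x| ^ (1 / θ) = (x ^ 2) ^ a := by
      rw [← sq_abs, ← Real.rpow_natCast, ← Real.rpow_mul (abs_nonneg _)]
      congr 1
      rw [ha_def]; push_cast; field_simp
    rw [hx, div_mul_eq_mul_div, ← Real.mul_rpow (by norm_num) (by positivity)]
    have h2 : 1 / 4 * x ^ 2 ≤ (1 + z.re ^ 2) / 2 := by
      have := sq_le_sq' (abs_le.1 hre).1 (abs_le.1 hre).2
      nlinarith [sq_nonneg (2 * z.re - x)]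
    gcongr

/-- This is `u^n ≤ n! e^u` raised to the power `θ`, with `u = c |x|^(1/θ) / θ`. -/
lemma abs_pow_mul_exp_neg_le {θ c : ℝ} (hθ : 0 < θ) (hc : 0 < c) (n : ℕ) (x : ℝ) :
    |x| ^ n * Real.exp (-(c * |x| ^ (1 / θ))) ≤
      ((θ / c) ^ θ) ^ n * (n.factorial : ℝ) ^ θ := by
  set u : ℝ := c * |x| ^ (1 / θ) / θ with hu_def
  have hu : 0 ≤ u := by positivity
  have h1 : u ^ n ≤ n.factorial * Real.exp u := by
    have := Real.pow_div_factorial_le_exp u hu n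
    rwa [div_le_iff₀ (by positivity), mul_comm] at this
  have h2 : (u ^ n) ^ θ ≤ (n.factorial * Real.exp u) ^ θ := by gcongr
  have h3 : u ^ θ = (c / θ) ^ θ * |x| := by
    have : u = c / θ * |x| ^ (1 / θ) := by rw [hu_def]; ring
    rw [this, Real.mul_rpow (by positivity) (by positivity),
      ← Real.rpow_mul (abs_nonneg _), one_div_mul_cancel hθ.ne', Real.rpow_one]
  have h4 : (u ^ n) ^ θ = ((c / θ) ^ θ) ^ n * |x| ^ n := by
    rw [← Real.rpow_natCast, ← Real.rpow_mul hu, mul_comm, Real.rpow_mul hu, Real.rpow_natCast,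
      h3, mul_pow]
  have h5 : (n.factorial * Real.exp u) ^ θ =
      (n.factorial : ℝ) ^ θ * Real.exp (c * |x| ^ (1 / θ)) := by
    rw [Real.mul_rpow (by positivity) (by positivity), ← Real.exp_mul]
    congr 2
    rw [hu_def]; field_simp
  rw [h4, h5] at h2
  have h6 : ((θ / c) ^ θ) * ((c / θ) ^ θ) = 1 := by
    rw [← Real.mul_rpow (by positivity) (by positivity)]
    field_simp
    simp
  calc |x| ^ n * Real.exp (-(c * |x| ^ (1 / θ)))
      = ((θ / c) ^ θ) ^ n * (((c / θ) ^ θ) ^ n * |x| ^ n) * Real.exp (-(c * |x| ^ (1 / θ))) := by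
        rw [← mul_assoc, ← mul_pow, h6, one_pow, one_mul]
    _ ≤ ((θ / c) ^ θ) ^ n * ((n.factorial : ℝ) ^ θ * Real.exp (c * |x| ^ (1 / θ))) *
          Real.exp (-(c * |x| ^ (1 / θ))) := by gcongr
    _ = _ := by
        rw [mul_assoc, mul_assoc, ← Real.exp_add, add_neg_cancel, Real.exp_zero, mul_one]

lemma expBracket_mem_space {θ s : ℝ} (hθ : 0 < θ) (hs : 1 ≤ s) : expBracket θ ∈ space θ s := by
  obtain ⟨ρ, c, hρ, hc, hderiv⟩ := exists_norm_iteratedDeriv_expBracket_le hθ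
  have hA : 0 < (θ / c) ^ θ := by positivity
  simp only [space, Set.mem_iUnion]
  refine ⟨max ((θ / c) ^ θ) ρ⁻¹, lt_max_of_lt_left hA, ?_, 1, fun α β x => ?_⟩
  · rw [expBracket_eq]
    exact contDiff_comp_ofReal (analyticAt_complexExpBracket _)
  have hfac : (β.factorial : ℝ) ≤ (β.factorial : ℝ) ^ s :=
    Real.self_le_rpow_of_one_le (by exact_mod_cast β.factorial_pos) hs
  rw [norm_mul, norm_pow, norm_real, Real.norm_eq_abs, one_mul, pow_add]
  calc |x| ^ α * ‖iteratedDeriv β (expBracket θ) x‖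
      ≤ |x| ^ α * (β.factorial * Real.exp (-(c * |x| ^ (1 / θ))) / ρ ^ β) := by
        gcongr; exact hderiv β x
    _ = (|x| ^ α * Real.exp (-(c * |x| ^ (1 / θ)))) * (ρ⁻¹ ^ β * β.factorial) := by
        rw [inv_pow]; ring
    _ ≤ (((θ / c) ^ θ) ^ α * (α.factorial : ℝ) ^ θ) * (ρ⁻¹ ^ β * (β.factorial : ℝ) ^ s) := by
        exact mul_le_mul (abs_pow_mul_exp_neg_le hθ hc α x) (by gcongr) (by positivity)
          (by positivity)
    _ ≤ ((max ((θ / c) ^ θ) ρ⁻¹) ^ α * (α.factorial : ℝ) ^ θ) *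
          ((max ((θ / c) ^ θ) ρ⁻¹) ^ β * (β.factorial : ℝ) ^ s) := by
        gcongr
        · exact le_max_left _ _
        · exact le_max_right _ _
    _ = _ := by ring

/-! ### Upper and lower bounds for finite differences -/

lemma norm_iterate_fwdDiff_le {E : Type*} [NormedAddCommGroup E] [NormedSpace ℝ E] (t : ℝ)
    (N : ℕ) {f : ℝ → E} {M : ℝ} (hf : ContDiff ℝ ((⊤ : ℕ∞) : WithTop ℕ∞) f)
    (hM : ∀ x, ‖iteratedDeriv N f x‖ ≤ M) (x : ℝ) :
    ‖(fwdDiff t)^[N] f x‖ ≤ |t| ^ N * M := by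
  induction N generalizing f M with
  | zero => simpa using hM x
  | succ n ih =>
    have hshift : ContDiff ℝ ((⊤ : ℕ∞) : WithTop ℕ∞) (fun y => f (y + t)) :=
      hf.comp (contDiff_id.add contDiff_const)
    have hbound : ∀ y, ‖iteratedDeriv n (fwdDiff t f) y‖ ≤ M * |t| := by
      intro y
      have hn : ((n : ℕ∞) : WithTop ℕ∞) ≤ ((⊤ : ℕ∞) : WithTop ℕ∞) := by
        exact_mod_cast (le_top : (n : ℕ∞) ≤ ⊤)
      have h1 : iteratedDeriv n (fwdDiff t f) y =
          iteratedDeriv n f (y + t) - iteratedDeriv n f y := by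
        have h2 := iteratedDeriv_sub (n := n) (x := y) ((hshift.of_le hn).contDiffAt)
          ((hf.of_le hn).contDiffAt)
        rw [iteratedDeriv_comp_add_const] at h2
        exact h2
      have hd : Differentiable ℝ (iteratedDeriv n f) :=
        hf.differentiable_iteratedDeriv n (by exact_mod_cast (WithTop.coe_lt_top n))
      have h3 := Convex.norm_image_sub_le_of_norm_deriv_le (f := iteratedDeriv n f)
        (s := Set.univ) (x := y) (y := y + t) (C := M) (fun z _ => hd z)
        (fun z _ => by rw [← iteratedDeriv_succ]; exact hM z) convex_univ trivial trivial
      rw [h1]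
      simpa using h3
    rw [Function.iterate_succ_apply]
    refine (ih (hshift.sub hf) hbound).trans_eq ?_
    ring

lemma two_pow_mul_le_norm_iterate_fwdDiff {p φ : ℝ → ℝ} {x t L : ℝ} {N : ℕ} (hL : 0 ≤ L)
    (hp : ∀ k ≤ N, |p (x + k * t) - p x - k * Real.pi| ≤ 1)
    (hφ : ∀ k ≤ N, L ≤ φ (x + k * t)) :
    2 ^ N * (L / 2) ≤
      ‖(fwdDiff t)^[N] (fun y => Complex.exp (Complex.I * (p y : ℂ)) * (φ y : ℂ)) x‖ := by
  -- A unimodular factor removing the common phase; every term then has argument within 1 of zero,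
  -- so real parts add up.
  set w : ℂ := (-1) ^ N * Complex.exp (-(Complex.I * (p x : ℂ))) with hw
  have hwn : ‖w‖ = 1 := by
    rw [hw, norm_mul, norm_pow, norm_neg, norm_one, one_pow, one_mul, Complex.norm_exp]
    simp
  have hterm : ∀ k ≤ N, w * (((-1) ^ (N - k) * (N.choose k : ℤ)) •
      (Complex.exp (Complex.I * (p (x + k • t) : ℂ)) * (φ (x + k • t) : ℂ))) =
      ((N.choose k * φ (x + k * t) : ℝ) : ℂ) *
        Complex.exp (((p (x + k * t) - p x - k * Real.pi : ℝ) : ℂ) * Complex.I) := by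
    intro k hk
    obtain ⟨j, rfl⟩ := Nat.exists_eq_add_of_le hk
    have hsign : ((-1 : ℂ)) ^ k = Complex.exp (-((k : ℂ) * (Real.pi * Complex.I))) := by
      rw [Complex.exp_neg, Complex.exp_nat_mul, Complex.exp_pi_mul_I, ← inv_pow]
      norm_num
    have hexp : Complex.exp (((p (x + k * t) - p x - k * Real.pi : ℝ) : ℂ) * Complex.I) =
        (-1) ^ k * (Complex.exp (-(Complex.I * (p x : ℂ))) *
          Complex.exp (Complex.I * (p (x + k * t) : ℂ))) := by
      rw [hsign, ← Complex.exp_add, ← Complex.exp_add]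
      congr 1
      push_cast
      ring
    have hj : ((-1 : ℂ) ^ j) * (-1) ^ j = 1 := by
      rw [← mul_pow]; norm_num
    rw [hexp, hw, zsmul_eq_mul, nsmul_eq_mul, Nat.add_sub_cancel_left]
    push_cast
    rw [pow_add]
    linear_combination ((-1) ^ k * Complex.exp (-(Complex.I * (p x : ℂ))) * ((k + j).choose k) *
      Complex.exp (Complex.I * (p (x + k * t) : ℂ)) * (φ (x + k * t) : ℂ)) * hj
  have hsum : w * (fwdDiff t)^[N] (fun y => Complex.exp (Complex.I * (p y : ℂ)) * (φ y : ℂ)) x =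
      ∑ k ∈ Finset.range (N + 1), ((N.choose k * φ (x + k * t) : ℝ) : ℂ) *
        Complex.exp (((p (x + k * t) - p x - k * Real.pi : ℝ) : ℂ) * Complex.I) := by
    rw [fwdDiff_iter_eq_sum_shift, Finset.mul_sum]
    exact Finset.sum_congr rfl fun k hk => hterm k (Nat.lt_succ_iff.1 (Finset.mem_range.1 hk))
  have hnorm := congrArg norm hsum
  rw [norm_mul, hwn, one_mul] at hnorm
  rw [hnorm]
  refine le_trans ?_ (Complex.re_le_norm _)
  rw [Complex.re_sum]
  have hchoose : ∑ k ∈ Finset.range (N + 1), (N.choose k : ℝ) = 2 ^ N := by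
    exact_mod_cast Nat.sum_range_choose N
  rw [← hchoose, Finset.sum_mul]
  refine Finset.sum_le_sum fun k hk => ?_
  have hk' : k ≤ N := Nat.lt_succ_iff.1 (Finset.mem_range.1 hk)
  rw [Complex.re_ofReal_mul, Complex.exp_ofReal_mul_I_re]
  have hcos : 1 / 2 ≤ Real.cos (p (x + k * t) - p x - k * Real.pi) := by
    have h1 := Real.one_sub_sq_div_two_le_cos (x := p (x + k * t) - p x - k * Real.pi)
    have h2 := (sq_le_one_iff_abs_le_one _).2 (hp k hk')
    linarith
  have := hφ k hk'
  calc (N.choose k : ℝ) * (L / 2) = N.choose k * L * (1 / 2) := by ring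
    _ ≤ _ := by gcongr; exact mul_nonneg (by positivity) (hL.trans this)

/-! ### Polynomial estimates and asymptotics -/

/-- Two applications of the mean value inequality; Taylor's factor 1/2 is not needed. -/
lemma abs_eval_add_sub_le {q : Polynomial ℝ} {x u B : ℝ}
    (hB : ∀ y, |y - x| ≤ |u| → |q.derivative.derivative.eval y| ≤ B) :
    |q.eval (x + u) - q.eval x - q.derivative.eval x * u| ≤ B * u ^ 2 := by
  set S := Metric.closedBall x |u| with hS
  have hconv : Convex ℝ S := convex_closedBall _ _
  have hx : x ∈ S := Metric.mem_closedBall_self (abs_nonneg _)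
  have hxu : x + u ∈ S := by simp [hS, dist_eq_norm]
  have hmem : ∀ y ∈ S, |y - x| ≤ |u| := fun y hy => by
    simpa [hS, Real.dist_eq] using hy
  have hB0 : 0 ≤ B := (abs_nonneg _).trans (hB x (by simp))
  have h1 : ∀ y ∈ S, |q.derivative.eval y - q.derivative.eval x| ≤ B * |u| := by
    intro y hy
    have := Convex.norm_image_sub_le_of_norm_deriv_le (f := fun y => q.derivative.eval y)
      (s := S) (x := x) (y := y) (C := B) (fun z _ => q.derivative.differentiableAt)
      (fun z hz => by
        rw [Polynomial.deriv]; exact hB z (hmem z hz)) hconv hx hy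
    exact this.trans (mul_le_mul_of_nonneg_left (hmem y hy) hB0)
  have hder : ∀ y, HasDerivAt (fun y => q.eval y - q.derivative.eval x * y)
      (q.derivative.eval y - q.derivative.eval x) y := fun y => by
    have h := (hasDerivAt_id y).const_mul (q.derivative.eval x)
    rw [mul_one] at h
    exact (q.hasDerivAt y).sub h
  have h2 := Convex.norm_image_sub_le_of_norm_deriv_le
    (f := fun y => q.eval y - q.derivative.eval x * y)
    (s := S) (x := x) (y := x + u) (C := B * |u|) (fun z _ => (hder z).differentiableAt)
    (fun z hz => by rw [(hder z).deriv]; exact h1 z hz) hconv hx hxu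
  simp only [Real.norm_eq_abs, add_sub_cancel_left] at h2
  calc _ = |q.eval (x + u) - q.derivative.eval x * (x + u) -
        (q.eval x - q.derivative.eval x * x)| := by congr 1; ring
    _ ≤ B * |u| * |u| := h2
    _ = B * u ^ 2 := by rw [mul_assoc, abs_mul_abs_self, sq]

lemma exists_abs_eval_le_mul_pow {p : Polynomial ℝ} {d : ℕ} (hp : p.natDegree ≤ d) :
    ∃ B : ℝ, 0 ≤ B ∧ ∀ x y : ℝ, 1 ≤ x → |y| ≤ 2 * x → |p.eval y| ≤ B * x ^ d := by
  refine ⟨∑ i ∈ Finset.range (d + 1), |p.coeff i| * 2 ^ i, by positivity, fun x y hx hy => ?_⟩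
  rw [Polynomial.eval_eq_sum_range' (Nat.lt_succ_of_le hp), Finset.sum_mul]
  refine (Finset.abs_sum_le_sum_abs _ _).trans (Finset.sum_le_sum fun i hi => ?_)
  rw [abs_mul, abs_pow, mul_assoc]
  gcongr
  calc |y| ^ i ≤ (2 * x) ^ i := by gcongr
    _ = 2 ^ i * x ^ i := mul_pow _ _ _
    _ ≤ 2 ^ i * x ^ d := by
      exact mul_le_mul_of_nonneg_left
        (pow_le_pow_right₀ hx (Nat.lt_succ_iff.1 (Finset.mem_range.1 hi))) (by positivity)

lemma eventually_mul_pow_le_abs_eval {p : Polynomial ℝ} (hp : p ≠ 0) :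
    ∃ c : ℝ, 0 < c ∧ ∀ᶠ x : ℝ in atTop, c * x ^ p.natDegree ≤ |p.eval x| := by
  have hlc : 0 < |p.leadingCoeff| := abs_pos.2 (Polynomial.leadingCoeff_ne_zero.2 hp)
  obtain ⟨C, hC, h⟩ := p.isEquivalent_atTop_lead.symm.isBigO.exists_pos
  refine ⟨|p.leadingCoeff| / C, by positivity, ?_⟩
  filter_upwards [h.bound, eventually_ge_atTop 0] with x hx hx0
  rw [norm_mul, norm_pow, Real.norm_eq_abs, Real.norm_eq_abs, Real.norm_eq_abs,
    abs_of_nonneg hx0] at hx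
  rw [div_mul_eq_mul_div, div_le_iff₀ hC, mul_comm _ C]
  exact hx

lemma eventually_mul_rpow_le_one (K : ℝ) {r : ℝ} (hr : r < 0) :
    ∀ᶠ x : ℝ in atTop, K * x ^ r ≤ 1 := by
  have h := (tendsto_rpow_neg_atTop (neg_pos.2 hr)).const_mul K
  rw [neg_neg, mul_zero] at h
  exact (h.eventually_lt_const one_pos).mono fun _ => le_of_lt

lemma tendsto_exp_rpow_sub_rpow {σ τ c d e : ℝ} (hτ : 0 < τ) (hστ : τ < σ) (hc : 0 < c) :
    Tendsto (fun x : ℝ => Real.exp (c * x ^ σ - d * x ^ τ - e)) atTop atTop := by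
  refine Real.tendsto_exp_atTop.comp ?_
  have h1 : Tendsto (fun x : ℝ => x ^ τ * (c * x ^ (σ - τ) - d)) atTop atTop :=
    (tendsto_rpow_atTop hτ).atTop_mul_atTop₀
      (tendsto_atTop_add_const_right _ (-d)
        ((tendsto_rpow_atTop (sub_pos.2 hστ)).const_mul_atTop hc))
  refine (tendsto_atTop_add_const_right _ (-e) h1).congr' ?_
  filter_upwards [eventually_gt_atTop 0] with x hx
  have : x ^ σ = x ^ τ * x ^ (σ - τ) := by rw [← Real.rpow_add hx]; congr 1; ring
  rw [this]; ring

lemma exp_neg_le_exp_neg_sqrt_rpow {θ x y : ℝ} (hθ : 0 < θ) (hx : 1 ≤ x) (hy : |y| ≤ 2 * x) :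
    Real.exp (-(3 ^ (1 / θ) * x ^ (1 / θ))) ≤
      Real.exp (-(Real.sqrt (1 + y ^ 2) ^ (1 / θ))) := by
  rw [Real.exp_le_exp, neg_le_neg_iff, ← Real.mul_rpow (by norm_num) (by linarith)]
  have h : Real.sqrt (1 + y ^ 2) ≤ 3 * x := by
    rw [Real.sqrt_le_left (by linarith)]
    nlinarith [sq_abs y, abs_nonneg y]
  gcongr

lemma factorial_rpow_le {s a : ℝ} (hs : 0 ≤ s) {N : ℕ} (hN : (N : ℝ) ≤ a) :
    (N.factorial : ℝ) ^ s ≤ (a ^ s) ^ N := by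
  have ha : 0 ≤ a := (Nat.cast_nonneg N).trans hN
  have h : (N.factorial : ℝ) ≤ a ^ N :=
    (by exact_mod_cast N.factorial_le_pow : (N.factorial : ℝ) ≤ (N : ℝ) ^ N).trans (by gcongr)
  calc (N.factorial : ℝ) ^ s ≤ (a ^ N) ^ s := by gcongr
    _ = (a ^ s) ^ N := by
      rw [← Real.rpow_natCast, ← Real.rpow_mul ha, mul_comm, Real.rpow_mul ha, Real.rpow_natCast]

/-! ### Non-membership of the product -/

lemma exists_contDiff_of_mem_space {θ s : ℝ} {g : ℝ → ℂ} (hg : g ∈ space θ s) :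
    ContDiff ℝ ((⊤ : ℕ∞) : WithTop ℕ∞) g ∧ ∃ h C : ℝ, 0 < h ∧ 0 ≤ C ∧
      ∀ (n : ℕ) (x : ℝ), ‖iteratedDeriv n g x‖ ≤ C * (h ^ n * (n.factorial : ℝ) ^ s) := by
  simp only [space, Set.mem_iUnion] at hg
  obtain ⟨h, hh, hsm, C, hC⟩ := hg
  have hbound : ∀ (n : ℕ) (x : ℝ),
      ‖iteratedDeriv n g x‖ ≤ C * (h ^ n * (n.factorial : ℝ) ^ s) := fun n x => by
    simpa using hC 0 n x
  refine ⟨hsm, h, C, hh, ?_, hbound⟩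
  simpa using (norm_nonneg _).trans (hbound 0 0)

/-- If `1 / θ < min (m / 2) ((m - 1) / s)`, then high order finite differences of
`exp (i q) * expBracket θ` with steps `π / q'(x)` are too large for `space θ s`. -/
lemma expMultiplier_expBracket_notMem_space {q : Polynomial ℝ} {m : ℕ} (hm : 2 ≤ m)
    (hq : q.natDegree = m) {s θ : ℝ} (hs : 0 < s) (hθ : 0 < θ) (hθm : 2 < θ * m)
    (hsθ : s < θ * (m - 1)) :
    expMultiplier q (expBracket θ) ∉ space θ s := by
  intro hmem
  obtain ⟨hsm, h, C, hh, hC, hderiv⟩ := exists_contDiff_of_mem_space hmem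
  have hm' : (2 : ℝ) ≤ m := by exact_mod_cast hm
  -- `σ > 1/θ` lets `2^N` beat the decay, `σ < m/2` makes the quadratic phase error small, and `σ <
  -- (m-1)/s` controls the upper bound.
  obtain ⟨σ, hσ1, hσ2⟩ : ∃ σ, 1 / θ < σ ∧ σ < min ((m : ℝ) / 2) ((m - 1) / s) := by
    refine exists_between (lt_min ?_ ?_)
    · rw [div_lt_div_iff₀ hθ two_pos]; linarith
    · rw [div_lt_div_iff₀ hθ hs]; linarith
  have hσm : 2 * σ - m < 0 := by linarith [hσ2.trans_le (min_le_left _ _)]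
  have hσs : σ * s - (m - 1) < 0 := by
    have := hσ2.trans_le (min_le_right _ _)
    rw [lt_div_iff₀ hs] at this
    linarith
  have hθ' : 0 < 1 / θ := by positivity
  have hdeg : q.derivative.natDegree = m - 1 := by
    rw [Polynomial.natDegree_derivative, hq]
  have hq' : q.derivative ≠ 0 := by
    intro h0
    rw [h0, Polynomial.natDegree_zero] at hdeg
    omega
  have hdeg2 : q.derivative.derivative.natDegree ≤ m - 2 := by
    rw [Polynomial.natDegree_derivative, hdeg]; omega
  obtain ⟨c, hc, hlower⟩ := eventually_mul_pow_le_abs_eval hq'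
  obtain ⟨B, hB, hupper⟩ := exists_abs_eval_le_mul_pow hdeg2
  rw [hdeg] at hlower
  set K : ℝ := Real.pi / c with hK_def
  have hK : 0 < K := by positivity
  obtain ⟨x, hx1, hxq, hxa, hxb, hxc, hxd⟩ := ((eventually_ge_atTop (1 : ℝ)).and
    (hlower.and ((eventually_mul_rpow_le_one K (r := σ - m) (by linarith)).and
    ((eventually_mul_rpow_le_one (B * K ^ 2) hσm).and
    ((eventually_mul_rpow_le_one (K * h) hσs).and
    ((tendsto_exp_rpow_sub_rpow (d := 3 ^ (1 / θ)) (e := 2 * Real.log 2) hθ' hσ1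
      (Real.log_pos one_lt_two)).eventually_gt_atTop C)))))).exists
  have hx0 : 0 < x := by linarith
  set N : ℕ := ⌊x ^ σ⌋₊ with hN_def
  have hNle : (N : ℝ) ≤ x ^ σ := Nat.floor_le (by positivity)
  have hNge : x ^ σ - 1 ≤ N := by linarith [Nat.lt_floor_add_one (x ^ σ)]
  have hpow1 : x ^ (m - 1) = x ^ ((m : ℝ) - 1) := by
    rw [← Real.rpow_natCast, Nat.cast_sub (by omega)]; simp
  have hpow2 : x ^ (m - 2) = x ^ ((m : ℝ) - 2) := by
    rw [← Real.rpow_natCast, Nat.cast_sub hm]; simp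
  have hqpos : 0 < |q.derivative.eval x| := lt_of_lt_of_le (by positivity) hxq
  set t : ℝ := Real.pi / q.derivative.eval x with ht_def
  have htq : q.derivative.eval x * t = Real.pi := mul_div_cancel₀ _ (abs_pos.1 hqpos)
  have ht : |t| ≤ K * x ^ (-((m : ℝ) - 1)) := by
    rw [ht_def, abs_div, abs_of_pos Real.pi_pos, Real.rpow_neg hx0.le, ← hpow1, hK_def,
      ← div_eq_mul_inv, div_div]
    gcongr
  have hkt : ∀ k ≤ N, |(k : ℝ) * t| ≤ K * x ^ (σ - (m - 1)) := by
    intro k hk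
    have hk' : (k : ℝ) ≤ x ^ σ := le_trans (by exact_mod_cast hk) hNle
    rw [abs_mul, Nat.abs_cast]
    calc (k : ℝ) * |t| ≤ x ^ σ * (K * x ^ (-((m : ℝ) - 1))) := by gcongr
      _ = K * x ^ (σ - (m - 1)) := by rw [sub_eq_add_neg σ, Real.rpow_add hx0]; ring
  have hktx : ∀ k ≤ N, |(k : ℝ) * t| ≤ x := by
    intro k hk
    calc _ ≤ K * x ^ (σ - (m - 1)) := hkt k hk
      _ = (K * x ^ (σ - m)) * x := by
        rw [show σ - ((m : ℝ) - 1) = σ - m + 1 by ring, Real.rpow_add hx0, Real.rpow_one]; ring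
      _ ≤ 1 * x := by gcongr
      _ = x := one_mul x
  have hphase : ∀ k ≤ N, |q.eval (x + k * t) - q.eval x - k * Real.pi| ≤ 1 := by
    intro k hk
    have h1 := abs_eval_add_sub_le (q := q) (x := x) (u := k * t) (B := B * x ^ (m - 2))
      (fun y hy => hupper x y hx1 (by
        have h2 := hy.trans (hktx k hk)
        have h3 : |y| ≤ |y - x| + |x| := by simpa using abs_add_le (y - x) x
        rw [abs_of_pos hx0] at h3
        linarith))
    have h4 : q.derivative.eval x * (k * t) = k * Real.pi := by rw [← htq]; ring
    rw [h4] at h1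
    have h5 : ((k : ℝ) * t) ^ 2 ≤ (K * x ^ (σ - (m - 1))) ^ 2 := by
      rw [← sq_abs]
      have := hkt k hk
      gcongr
    calc _ ≤ B * x ^ (m - 2) * ((k : ℝ) * t) ^ 2 := h1
      _ ≤ B * x ^ (m - 2) * (K * x ^ (σ - (m - 1))) ^ 2 := by gcongr
      _ = B * K ^ 2 * x ^ (2 * σ - m) := by
        have h6 : x ^ (2 * σ - m) =
            x ^ ((m : ℝ) - 2) * (x ^ (σ - ((m : ℝ) - 1)) * x ^ (σ - ((m : ℝ) - 1))) := by
          rw [← Real.rpow_add hx0, ← Real.rpow_add hx0]; congr 1; ring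
        rw [hpow2, h6]; ring
      _ ≤ 1 := hxb
  have hlow := two_pow_mul_le_norm_iterate_fwdDiff
    (p := fun y => q.eval y) (L := Real.exp (-(3 ^ (1 / θ) * x ^ (1 / θ))))
    (φ := fun y => Real.exp (-(Real.sqrt (1 + y ^ 2) ^ (1 / θ)))) (Real.exp_pos _).le hphase
    (fun k hk => exp_neg_le_exp_neg_sqrt_rpow hθ hx1 (by
      have h2 := hktx k hk
      have h3 := abs_add_le x (k * t)
      rw [abs_of_pos hx0] at h3
      linarith))
  have hup := norm_iterate_fwdDiff_le t N hsm (hderiv N) x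
  have hle : |t| ^ N * (C * (h ^ N * (N.factorial : ℝ) ^ s)) ≤ C := by
    calc |t| ^ N * (C * (h ^ N * (N.factorial : ℝ) ^ s))
        ≤ (K * x ^ (-((m : ℝ) - 1))) ^ N * (C * (h ^ N * ((x ^ σ) ^ s) ^ N)) := by
          gcongr
          exact factorial_rpow_le hs.le hNle
      _ = C * (K * h * (x ^ (σ * s) * x ^ (-((m : ℝ) - 1)))) ^ N := by
          rw [Real.rpow_mul hx0.le]; simp only [mul_pow]; ring
      _ = C * (K * h * x ^ (σ * s - (m - 1))) ^ N := by
          rw [← Real.rpow_add hx0, ← sub_eq_add_neg]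
      _ ≤ C * 1 := by
          gcongr
          exact pow_le_one₀ (by positivity) hxc
      _ = C := mul_one C
  -- One `log 2` pays for the floor in `N`, the other for the factor 1/2.
  have hbig : Real.exp (Real.log 2 * x ^ σ - 3 ^ (1 / θ) * x ^ (1 / θ) - 2 * Real.log 2) ≤
      2 ^ N * (Real.exp (-(3 ^ (1 / θ) * x ^ (1 / θ))) / 2) := by
    have h2 : (2 : ℝ) ^ N = Real.exp (Real.log 2 * N) := by
      rw [← Real.rpow_natCast, Real.rpow_def_of_pos two_pos]
    have h3 : Real.exp (-(3 ^ (1 / θ) * x ^ (1 / θ))) / 2 =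
        Real.exp (-(3 ^ (1 / θ) * x ^ (1 / θ)) - Real.log 2) := by
      rw [Real.exp_sub, Real.exp_log two_pos]
    rw [h2, h3, ← Real.exp_add, Real.exp_le_exp]
    have := mul_le_mul_of_nonneg_left hNge (Real.log_pos one_lt_two).le
    linarith
  exact absurd (hxd.trans_le (hbig.trans (hlow.trans (hup.trans hle)))) (lt_irrefl C)

end GelfandShilov

theorem theorem1p2 (q : Polynomial ℝ) (m : ℕ) (hm : 2 ≤ m) (hq : q.natDegree = m)
    (s θ : ℝ) (hs_pos : 0 < s) (hθ_pos : 0 < θ)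
    (hs_ge : 1 ≤ s) (hs_lt : s < θ * (m : ℝ) - max θ 1)
    (hm3 : m = 3 → 1 ≤ θ) :
    ¬ (GelfandShilov.expMultiplier q '' GelfandShilov.space θ s ⊆ GelfandShilov.space θ s) ∧
      GelfandShilov.expBracket θ ∈ GelfandShilov.space θ 1 ∧
      GelfandShilov.expBracket θ ∈ GelfandShilov.space θ s ∧
      GelfandShilov.expMultiplier q (GelfandShilov.expBracket θ) ∉ GelfandShilov.space θ s := by

  have hmax1 := le_max_left θ 1
  have hmax2 := le_max_right θ 1
  have hf : GelfandShilov.expBracket θ ∈ GelfandShilov.space θ s :=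
    GelfandShilov.expBracket_mem_space hθ_pos hs_ge
  -- `max θ 1 ≥ 1` with `s ≥ 1` gives `θ m > 2`; `max θ 1 ≥ θ` gives `s < θ (m - 1)`.
  have hTf := GelfandShilov.expMultiplier_expBracket_notMem_space hm hq hs_pos hθ_pos
    (by linarith) (by linarith)
  exact ⟨fun hsub => hTf (hsub ⟨_, hf, rfl⟩),
    GelfandShilov.expBracket_mem_space hθ_pos le_rfl, hf, hTf⟩
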